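/- Let $n\ge 2$ be an integer and let $U:[-1,1]\to\mathbb{R}$ be twice continuously differentiable. For an integer $L\ge 1$, let $\mathbb{T}_L^2$ be the two-dimensional discrete torus of side length $2L$: its vertex set is $\{-L+1,-L+2,\ldots,L\}^2$, and two vertices are adjacent if they are equal in all but one coordinate and differ by exactly $1$ modulo $2L$ in that coordinate. Write $\|x-y\|_1$ for the graph distance between $x$ and $y$ in $\mathbb{T}_L^2$. Let $\sigma:V(\mathbb{T}_L^2)\to\mathbb{S}^{n-1}$ be sampled from the spin $O(n)$ model on $\mathbb{T}_L^2$ with potential $U$, that is, from the probability measure $$\frac{1}{Z}\exp\Big[-\sum_{\{u,v\}\in E(\mathbb{T}_L^2)}U(\langle\sigma_u,\sigma_v\rangle)\Big]\,d\sigma,$$ where $d\sigma$ is the product over the vertices of the uniform probability measures on the unit sphere $\mathbb{S}^{n-1}\subset\mathbb{R}^n$ and $Z$ is the normalizing constant. Then there exist constants $C_{n,U},c_{n,U}>0$, depending only on $n$ and $U$ (and not on $L$), such that for every $L\ge 1$ and all distinct $x,y\in V(\mathbb{T}_L^2)$, $$\big|\mathbb{E}\langle\sigma_x,\sigma_y\rangle\big|\le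 C_{n,U}\,\|x-y\|_1^{-c_{n,U}}.$$ -/

import Mathlib

open MeasureTheory

/-- The vertex set `{-L+1, …, L}^d` of the `d`-dimensional discrete torus of side length `2L`. -/
abbrev TorusVertex (d L : ℕ) : Type :=
  Fin d → Finset.Ioc (-(L : ℤ)) (L : ℤ)

/-- The `d`-dimensional discrete torus of side length `2L`: two vertices are adjacent if they are
equal in all but one coordinate and differ by exactly `1` modulo `2L` in that coordinate. -/
def torusGraph (d L : ℕ) : SimpleGraph (TorusVertex d L) where
  Adj u v := ∃ i, (∀ j, j ≠ i → u j = v j) ∧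
    ((u i : ℤ) - v i ≡ 1 [ZMOD 2 * L] ∨ (v i : ℤ) - u i ≡ 1 [ZMOD 2 * L])
  symm := ⟨by
    rintro u v ⟨i, h, h'⟩
    exact ⟨i, fun j hj => (h j hj).symm, h'.symm⟩⟩
  loopless := ⟨by
    rintro u ⟨i, -, h⟩
    rw [sub_self, or_self, Int.modEq_iff_dvd, sub_zero] at h
    have := (Dvd.intro _ rfl).trans h
    omega⟩

instance torusGraph.decidableRelAdj (d L : ℕ) : DecidableRel (torusGraph d L).Adj := fun u v =>
  inferInstanceAs (Decidable (∃ i, (∀ j, j ≠ i → u j = v j) ∧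
    ((u i : ℤ) - v i ≡ 1 [ZMOD 2 * L] ∨ (v i : ℤ) - u i ≡ 1 [ZMOD 2 * L])))

/-- The unit sphere `𝕊^{n-1}` of `ℝ^n`. -/
abbrev SpinSphere (n : ℕ) : Type :=
  Metric.sphere (0 : EuclideanSpace ℝ (Fin n)) 1

noncomputable section

/-- The uniform probability measure on `𝕊^{n-1}`: the normalized surface measure. -/
def uniformSphere (n : ℕ) : Measure (SpinSphere n) :=
  ((volume : Measure (EuclideanSpace ℝ (Fin n))).toSphere Set.univ)⁻¹ •
    (volume : Measure (EuclideanSpace ℝ (Fin n))).toSphere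

/-- The energy `∑_{{u,v} ∈ E(G)} U(⟨σ_u, σ_v⟩)` of a configuration `σ : V → 𝕊^{n-1}`, the sum
being over unordered edges. -/
def spinEnergy {V : Type*} (G : SimpleGraph V) [Fintype G.edgeSet] (n : ℕ) (U : ℝ → ℝ)
    (σ : V → SpinSphere n) : ℝ :=
  ∑ e ∈ G.edgeFinset,
    Sym2.lift ⟨fun u v => U (inner ℝ (σ u : EuclideanSpace ℝ (Fin n)) (σ v)),
      fun _ _ => congrArg U (real_inner_comm _ _)⟩ e

/-- The spin `O(n)` model on the finite graph `G` with potential `U`: the measure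
`Z⁻¹ exp(-∑_{{u,v} ∈ E(G)} U(⟨σ_u, σ_v⟩)) dσ` on configurations, where `dσ` is the product of the
uniform probability measures on the spheres and `Z` is the total mass of the exponential weight. -/
def spinMeasure {V : Type*} [Fintype V] (G : SimpleGraph V) [Fintype G.edgeSet] (n : ℕ)
    (U : ℝ → ℝ) : Measure (V → SpinSphere n) :=
  (Measure.pi fun _ : V => uniformSphere n).tilted fun σ => -spinEnergy G n U σ

/-- The correlation `ρ_{x,y} = 𝔼⟨σ_x, σ_y⟩` in the spin `O(n)` model on `G` with potential `U`. -/
def spinCorrelation {V : Type*} [Fintype V] (G : SimpleGraph V) [Fintype G.edgeSet] (n : ℕ)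
    (U : ℝ → ℝ) (x y : V) : ℝ :=
  ∫ σ, inner ℝ (σ x : EuclideanSpace ℝ (Fin n)) (σ y) ∂spinMeasure G n U

end

/-! This is a Mermin–Wagner argument by averaging over slowly varying rotations. Put `r = dist x y`
and use about `log₂ r` cutoffs `φ k`, each a function of the distance to `x`: `φ k` is `1` up to
distance `2 ^ k` and `0` beyond `2 ^ (k + 1)`. No edge sees the gradient of two cutoffs, and in
dimension two every Dirichlet energy is at most a constant (`card_edges_near_le`).

Rotate each spin `σ u` in a coordinate plane by the angle `∑ k, t k * φ k u`. The reference measure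
is invariant, so one may average over `t`. For fixed `σ` the energy changes by a sum of functions of
the single `t k` (`edgeEnergy_rotateSpins`), so the `t k` are independent under the Gibbs weight.
The spin at `x` turns by `∑ k, t k` and the spin at `y` stays put, so the average is a product of
first Fourier coefficients.

A `C²` potential has second differences along a rotation of order the squared angle
(`second_difference_le`). Hence each one-variable weight `f` satisfies `f t ^ 2 ≤ D * f (t + π/2) *
f (t - π/2)` with `D` uniform, and `norm_integral_exp_mul_le` makes its Fourier coefficient smaller
than its mass by a factor `q < 1`. The product `q ^ log₂ r` is a negative power of `r`. -/

/-! ### Rotation invariance of the uniform measure on the sphere. -/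

/-- A linear isometry equivalence acting on the unit sphere. -/
def sphereMap {E : Type*} [NormedAddCommGroup E] [NormedSpace ℝ E] (f : E ≃ₗᵢ[ℝ] E)
    (v : Metric.sphere (0 : E) 1) : Metric.sphere (0 : E) 1 :=
  ⟨f v, by simp⟩

theorem coe_sphereMap {E : Type*} [NormedAddCommGroup E] [NormedSpace ℝ E] (f : E ≃ₗᵢ[ℝ] E)
    (v : Metric.sphere (0 : E) 1) : (sphereMap f v : E) = f v := rfl

/-- The surface measure of `s` is a dimensional constant times the volume of the cone over `s` of
radii in `(0, 1)`, and a linear isometry maps cones to cones. -/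
theorem measurePreserving_sphereMap {E : Type*} [NormedAddCommGroup E] [NormedSpace ℝ E]
    [MeasurableSpace E] [BorelSpace E] (f : E ≃ₗᵢ[ℝ] E) {μ : Measure E}
    (hf : MeasurePreserving f μ μ) :
    MeasurePreserving (sphereMap f) μ.toSphere μ.toSphere := by
  have hc : Continuous (sphereMap f) := by
    unfold sphereMap
    exact (f.continuous.comp continuous_subtype_val).subtype_mk _
  refine ⟨hc.measurable, ?_⟩
  ext s hs
  rw [Measure.map_apply hc.measurable hs, Measure.toSphere_apply' _ (hc.measurable hs),
    Measure.toSphere_apply' _ hs]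
  congr 1
  refine Eq.trans ?_ (hf.measure_preimage_equiv (f := f.toHomeomorph.toMeasurableEquiv) _)
  congr 1
  ext v
  simp only [Set.mem_smul, Set.mem_image, Set.mem_preimage]
  constructor
  · rintro ⟨r, hr, _, ⟨w, hw, rfl⟩, rfl⟩
    exact ⟨r, hr, _, ⟨_, hw, rfl⟩, (map_smul f r (w : E)).symm⟩
  · rintro ⟨r, hr, _, ⟨w, hw, rfl⟩, h⟩
    refine ⟨r, hr, _, ⟨sphereMap f.symm w, ?_, rfl⟩, ?_⟩
    · have : sphereMap f (sphereMap f.symm w) = w := Subtype.ext (by simp [sphereMap])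
      rwa [this]
    · apply f.injective
      simpa [sphereMap] using h

theorem isProbabilityMeasure_uniformSphere {n : ℕ} (hn : 1 ≤ n) :
    IsProbabilityMeasure (uniformSphere n) := by
  have : Nonempty (Fin n) := ⟨⟨0, hn⟩⟩
  refine ⟨?_⟩
  rw [uniformSphere, Measure.smul_apply, smul_eq_mul]
  refine ENNReal.inv_mul_cancel ?_ (measure_ne_top _ _)
  rw [Measure.measure_univ_ne_zero]
  exact Measure.toSphere_ne_zero _

theorem measurePreserving_sphereMap_uniformSphere {n : ℕ}
    (f : EuclideanSpace ℝ (Fin n) ≃ₗᵢ[ℝ] EuclideanSpace ℝ (Fin n)) :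
    MeasurePreserving (sphereMap f) (uniformSphere n) (uniformSphere n) :=
  (measurePreserving_sphereMap f f.measurePreserving).smul_measure _

/-! ### Rotations of a coordinate plane. -/

/-- The linear map rotating the coordinate plane `(i, j)` by the angle `θ`. -/
noncomputable def planeRotationAux {n : ℕ} (i j : Fin n) (θ : ℝ) :
    EuclideanSpace ℝ (Fin n) →ₗ[ℝ] EuclideanSpace ℝ (Fin n) where
  toFun v := WithLp.toLp 2 fun l => if l = i then Real.cos θ * v i - Real.sin θ * v j
    else if l = j then Real.sin θ * v i + Real.cos θ * v j else v l
  map_add' v w := by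
    ext l
    simp only [PiLp.add_apply]
    split_ifs <;> ring
  map_smul' c v := by
    ext l
    simp only [PiLp.smul_apply, smul_eq_mul, RingHom.id_apply]
    split_ifs <;> ring

/-- Coordinates outside the plane cancel in the difference. The angles enter only through `α - β`,
so only gradients of the angle field affect the energy. -/
theorem inner_planeRotationAux {n : ℕ} {i j : Fin n} (hij : i ≠ j) (α β : ℝ)
    (v w : EuclideanSpace ℝ (Fin n)) :
    inner ℝ (planeRotationAux i j α v) (planeRotationAux i j β w) = inner ℝ v w
      + ((v i * w i + v j * w j) * (Real.cos (α - β) - 1)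
        + (v i * w j - v j * w i) * Real.sin (α - β)) := by
  rw [← sub_eq_iff_eq_add', PiLp.inner_apply, PiLp.inner_apply, ← Finset.sum_sub_distrib,
    Finset.sum_eq_add i j hij]
  · simp only [planeRotationAux, LinearMap.coe_mk, AddHom.coe_mk, if_true, hij.symm, if_false,
      Real.cos_sub, Real.sin_sub, RCLike.inner_apply, conj_trivial]
    ring
  · rintro l - ⟨hi, hj⟩
    simp [planeRotationAux, hi, hj]
  · simp
  · simp

/-- The rotation of the coordinate plane `(i, j)` by the angle `θ`. -/
noncomputable def planeRotation {n : ℕ} {i j : Fin n} (hij : i ≠ j) (θ : ℝ) :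
    EuclideanSpace ℝ (Fin n) ≃ₗᵢ[ℝ] EuclideanSpace ℝ (Fin n) :=
  LinearIsometry.toLinearIsometryEquiv ⟨planeRotationAux i j θ, fun v => by
    rw [@norm_eq_sqrt_real_inner _ _ _ v, @norm_eq_sqrt_real_inner _ _ _ (planeRotationAux _ _ _ v),
      inner_planeRotationAux hij]
    simp⟩ rfl

theorem planeRotation_apply {n : ℕ} {i j : Fin n} (hij : i ≠ j) (θ : ℝ)
    (v : EuclideanSpace ℝ (Fin n)) : planeRotation hij θ v = planeRotationAux i j θ v := rfl

theorem planeRotation_zero {n : ℕ} {i j : Fin n} (hij : i ≠ j)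
    (v : EuclideanSpace ℝ (Fin n)) : planeRotation hij 0 v = v := by
  ext l
  rw [planeRotation_apply]
  simp only [planeRotationAux, LinearMap.coe_mk, AddHom.coe_mk]
  split_ifs with h1 h2 <;> simp [*]

theorem inner_planeRotation {n : ℕ} {i j : Fin n} (hij : i ≠ j) (α β : ℝ)
    (v w : EuclideanSpace ℝ (Fin n)) :
    inner ℝ (planeRotation hij α v) (planeRotation hij β w) = inner ℝ v w
      + ((v i * w i + v j * w j) * (Real.cos (α - β) - 1)
        + (v i * w j - v j * w i) * Real.sin (α - β)) :=
  inner_planeRotationAux hij α β v w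

theorem planeRotation_apply_left {n : ℕ} {i j : Fin n} (hij : i ≠ j) (θ : ℝ)
    (v : EuclideanSpace ℝ (Fin n)) :
    planeRotation hij θ v i = Real.cos θ * v i - Real.sin θ * v j := by
  rw [planeRotation_apply]
  simp [planeRotationAux]

theorem continuous_planeRotation {n : ℕ} {i j : Fin n} (hij : i ≠ j) :
    Continuous fun p : ℝ × EuclideanSpace ℝ (Fin n) => planeRotation hij p.1 p.2 := by
  simp only [planeRotation_apply, planeRotationAux, LinearMap.coe_mk, AddHom.coe_mk]
  refine (PiLp.continuous_toLp 2 _).comp (continuous_pi fun l => ?_)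
  split_ifs <;> fun_prop

attribute [irreducible] planeRotation planeRotationAux

/-! ### A bound on first Fourier coefficients. -/

theorem mul_div_add_ge {a b m D : ℝ} (ha : 0 < a) (hb : 0 < b) (hD : 0 < D)
    (h : m ^ 2 ≤ D * (a * b)) : m / D - (a + b) / (4 * D) ≤ a * b / (a + b) := by
  rw [div_sub_div _ _ hD.ne' (by positivity), div_le_div_iff₀ (by positivity) (by positivity)]
  have h1 : m * (a + b) ≤ m ^ 2 + (a + b) ^ 2 / 4 := by nlinarith [sq_nonneg (m - (a + b) / 2)]
  have h2 : (m * (4 * D) - D * (a + b)) * (a + b) = 4 * D * (m * (a + b) - (a + b) ^ 2 / 4) := by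
    ring
  rw [h2]
  nlinarith [mul_le_mul_of_nonneg_left h (by positivity : (0 : ℝ) ≤ 4 * D),
    mul_le_mul_of_nonneg_left h1 (by positivity : (0 : ℝ) ≤ 4 * D)]

/-- Start from `|a - b| ≤ (a² + b²) / (a + b) = a + b - 2ab / (a + b)` and bound the last fraction
below. The final bound is linear in `a`, `b`, `m`, so it can be integrated when these are values of
one function. -/
theorem abs_sub_le_of_sq_le {a b m D : ℝ} (ha : 0 < a) (hb : 0 < b) (hD : 0 < D)
    (h : m ^ 2 ≤ D * (a * b)) :
    |a - b| ≤ (a + b) * (1 + 1 / (2 * D)) - 2 / D * m := by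
  have h1 := mul_div_add_ge ha hb hD h
  have h2 : |a - b| ≤ (a + b) - 2 * (a * b / (a + b)) := by
    have h3 : a + b - 2 * (a * b / (a + b)) = (a ^ 2 + b ^ 2) / (a + b) := by
      field_simp; ring
    rw [h3, le_div_iff₀ (by positivity), ← abs_of_pos (by positivity : 0 < a + b), ← abs_mul,
      abs_le]
    constructor <;> nlinarith [sq_nonneg a, sq_nonneg b]
  have h4 : (a + b) * (1 + 1 / (2 * D)) - 2 / D * m
      = (a + b) - 2 * (m / D - (a + b) / (4 * D)) := by
    field_simp; ring
  rw [h4]; linarith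

/-- A positive periodic function which is approximately log-concave from below at the scale `π / 2`
has a first Fourier coefficient that is smaller than its mean by a definite factor. -/
theorem norm_integral_exp_mul_le {f : ℝ → ℝ} (hf : Continuous f) (hpos : ∀ t, 0 < f t) {N : ℕ}
    (hper : Function.Periodic f (2 * Real.pi * N)) {D : ℝ} (hD : 0 < D)
    (h : ∀ t, f t ^ 2 ≤ D * (f (t + Real.pi / 2) * f (t - Real.pi / 2))) :
    ‖∫ t in (0 : ℝ)..2 * Real.pi * N, Complex.exp (t * Complex.I) * f t‖
      ≤ (1 - 1 / (2 * D)) * ∫ t in (0 : ℝ)..2 * Real.pi * N, f t := by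
  set P := 2 * Real.pi * N with hP
  have hP0 : 0 ≤ P := by positivity
  have shift : ∀ {F : Type} [NormedAddCommGroup F] [NormedSpace ℝ F] (g : ℝ → F),
      Function.Periodic g P → ∀ s, ∫ t in (0 : ℝ)..P, g (t + s) = ∫ t in (0 : ℝ)..P, g t := by
    intro F _ _ g hg s
    rw [intervalIntegral.integral_comp_add_right, zero_add, add_comm P,
      hg.intervalIntegral_add_eq s 0, zero_add]
  set g : ℝ → ℂ := fun t => Complex.exp (t * Complex.I) * f t with hg
  have hgc : Continuous g := by fun_prop
  have hgper : Function.Periodic g P := by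
    intro t
    simp only [hg, hper t]
    congr 1
    rw [hP]
    push_cast
    rw [add_mul, show (2 * Real.pi * N * Complex.I : ℂ) = N * (2 * Real.pi * Complex.I) by ring]
    exact Complex.exp_periodic.nat_mul N _
  -- Shifting by `±π/2` multiplies the character by `±I`, so twice the Fourier integral becomes an
  -- integral of differences of `f`.
  have e1 : ∀ t, g (t + Real.pi / 2) + g (t + -(Real.pi / 2))
      = Complex.exp (t * Complex.I) * Complex.I *
        ((f (t + Real.pi / 2) - f (t - Real.pi / 2) : ℝ) : ℂ) := by
    intro t
    have hp : Complex.exp (((t + Real.pi / 2 : ℝ) : ℂ) * Complex.I)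
        = Complex.exp (t * Complex.I) * Complex.I := by
      push_cast
      rw [add_mul, Complex.exp_add, Complex.exp_pi_div_two_mul_I]
    have hm : Complex.exp (((t - Real.pi / 2 : ℝ) : ℂ) * Complex.I)
        = Complex.exp (t * Complex.I) * -Complex.I := by
      push_cast
      rw [sub_eq_add_neg, add_mul, Complex.exp_add, ← neg_div, Complex.exp_neg_pi_div_two_mul_I]
    simp only [hg, ← sub_eq_add_neg t]
    rw [hp, hm]
    push_cast
    ring
  have e2 : 2 * ∫ t in (0 : ℝ)..P, g t
      = ∫ t in (0 : ℝ)..P, (g (t + Real.pi / 2) + g (t + -(Real.pi / 2))) := by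
    rw [intervalIntegral.integral_add, shift g hgper, shift g hgper, two_mul]
    all_goals exact Continuous.intervalIntegrable (by fun_prop) _ _
  have e3 : ‖∫ t in (0 : ℝ)..P, (g (t + Real.pi / 2) + g (t + -(Real.pi / 2)))‖
      ≤ ∫ t in (0 : ℝ)..P, ((f (t + Real.pi / 2) + f (t + -(Real.pi / 2))) * (1 + 1 / (2 * D))
        - 2 / D * f t) := by
    refine intervalIntegral.norm_integral_le_of_norm_le hP0 (Filter.Eventually.of_forall ?_)
      (Continuous.intervalIntegrable (by fun_prop) _ _)
    intro t _
    rw [e1, norm_mul, norm_mul, Complex.norm_exp_ofReal_mul_I, Complex.norm_I, one_mul, one_mul,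
      Complex.norm_real, Real.norm_eq_abs, ← sub_eq_add_neg]
    exact abs_sub_le_of_sq_le (hpos _) (hpos _) hD (h t)
  have e4 : ∫ t in (0 : ℝ)..P, (f (t + Real.pi / 2) + f (t + -(Real.pi / 2)))
      = (∫ t in (0 : ℝ)..P, f t) + ∫ t in (0 : ℝ)..P, f t := by
    rw [intervalIntegral.integral_add, shift f hper, shift f hper]
    all_goals exact Continuous.intervalIntegrable (by fun_prop) _ _
  rw [intervalIntegral.integral_sub, intervalIntegral.integral_mul_const,
    intervalIntegral.integral_const_mul, e4, ← e2, norm_mul] at e3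
  · simp only [Complex.norm_ofNat] at e3
    have : (1 - 1 / (2 * D)) * ∫ t in (0 : ℝ)..P, f t = (1 / 2) * (((∫ t in (0 : ℝ)..P, f t) +
        ∫ t in (0 : ℝ)..P, f t) * (1 + 1 / (2 * D)) - 2 / D * ∫ t in (0 : ℝ)..P, f t) := by
      field_simp; ring
    rw [this]
    linarith
  all_goals exact Continuous.intervalIntegrable (by fun_prop) _ _

/-! ### Second differences of the potential along rotations. -/

/-- `D` is the derivative within the interval and `M` bounds both derivatives; the remainder comes
from the mean value inequality for `z ↦ U z - D p * z`. -/
theorem exists_taylor_bound {U : ℝ → ℝ} (hU : ContDiffOn ℝ 2 U (Set.Icc (-1) 1)) :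
    ∃ (D : ℝ → ℝ) (M : ℝ), 0 < M ∧ ∀ p ∈ Set.Icc (-1 : ℝ) 1, |D p| ≤ M ∧
      ∀ q ∈ Set.Icc (-1 : ℝ) 1, |U q - U p - D p * (q - p)| ≤ M * (q - p) ^ 2 := by
  set I := Set.Icc (-1 : ℝ) 1 with hI
  have hu : UniqueDiffOn ℝ I := uniqueDiffOn_Icc (by norm_num)
  have h1 : ContDiffOn ℝ 1 (derivWithin U I) I := hU.derivWithin hu (by norm_num)
  have h2 : ContDiffOn ℝ 0 (derivWithin (derivWithin U I) I) I := h1.derivWithin hu (by norm_num)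
  obtain ⟨M₁, hM₁⟩ := isCompact_Icc.exists_bound_of_continuousOn h1.continuousOn
  obtain ⟨M₂, hM₂⟩ := isCompact_Icc.exists_bound_of_continuousOn h2.continuousOn
  have hM : ∀ p ∈ I, |derivWithin U I p| ≤ max M₁ M₂ := fun p hp =>
    (hM₁ p hp).trans (le_max_left _ _)
  refine ⟨derivWithin U I, max 1 (max M₁ M₂), by positivity, fun p hp =>
    ⟨(hM p hp).trans (le_max_right _ _), fun q hq => ?_⟩⟩
  have hsub : Set.uIcc p q ⊆ I := Set.ordConnected_Icc.uIcc_subset hp hq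
  have key := Convex.norm_image_sub_le_of_norm_hasDerivWithin_le
    (f := fun z => U z - derivWithin U I p * z)
    (f' := fun z => derivWithin U I z - derivWithin U I p * 1)
    (C := max M₁ M₂ * |q - p|) (s := Set.uIcc p q) (x := p) (y := q) ?_ ?_ (convex_uIcc p q)
    Set.left_mem_uIcc Set.right_mem_uIcc
  · have e : (U q - derivWithin U I p * q) - (U p - derivWithin U I p * p)
        = U q - U p - derivWithin U I p * (q - p) := by ring
    simp only [e, Real.norm_eq_abs] at key
    refine key.trans ?_
    rw [mul_assoc, abs_mul_abs_self, ← sq]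
    exact mul_le_mul_of_nonneg_right (le_max_right _ _) (sq_nonneg _)
  · intro z hz
    exact ((((hU.differentiableOn (by norm_num)) z (hsub hz)).hasDerivWithinAt.mono hsub).sub
      ((hasDerivWithinAt_id z _).const_mul _))
  · intro z hz
    rw [mul_one]
    refine ((convex_Icc (-1 : ℝ) 1).norm_image_sub_le_of_norm_derivWithin_le
      (h1.differentiableOn (by norm_num)) (fun w hw => (hM₂ w hw).trans (le_max_right M₁ M₂))
      hp (hsub hz)).trans ?_
    refine mul_le_mul_of_nonneg_left ?_ ((abs_nonneg _).trans (hM p hp))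
    rw [Real.norm_eq_abs]
    exact Set.abs_sub_left_of_mem_uIcc hz

theorem abs_mul_add_mul_le {B C c s r : ℝ} (hB : |B| ≤ 2) (hC : |C| ≤ 2) (hc : |c| ≤ r)
    (hs : |s| ≤ r) : |B * c + C * s| ≤ 4 * r := by
  have h1 : |B * c| ≤ 2 * r := by
    rw [abs_mul]; exact mul_le_mul hB hc (abs_nonneg _) (by norm_num)
  have h2 : |C * s| ≤ 2 * r := by
    rw [abs_mul]; exact mul_le_mul hC hs (abs_nonneg _) (by norm_num)
  linarith [abs_add_le (B * c) (C * s)]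

/-- The second difference of a potential along a rotation of one of its two arguments. -/
theorem second_difference_le {U D : ℝ → ℝ} {M : ℝ}
    (hD : ∀ p ∈ Set.Icc (-1 : ℝ) 1, |D p| ≤ M ∧
      ∀ q ∈ Set.Icc (-1 : ℝ) 1, |U q - U p - D p * (q - p)| ≤ M * (q - p) ^ 2)
    {A B C : ℝ} (hB : |B| ≤ 2) (hC : |C| ≤ 2)
    (hp : ∀ τ, A + (B * (Real.cos τ - 1) + C * Real.sin τ) ∈ Set.Icc (-1 : ℝ) 1) (τ s : ℝ) :
    U (A + (B * (Real.cos (τ + s) - 1) + C * Real.sin (τ + s)))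
      + U (A + (B * (Real.cos (τ - s) - 1) + C * Real.sin (τ - s)))
      - 2 * U (A + (B * (Real.cos τ - 1) + C * Real.sin τ)) ≤ 36 * M * s ^ 2 := by
  set p : ℝ → ℝ := fun τ => A + (B * (Real.cos τ - 1) + C * Real.sin τ) with hpdef
  change U (p (τ + s)) + U (p (τ - s)) - 2 * U (p τ) ≤ _
  obtain ⟨hM, hq⟩ := hD (p τ) (hp τ)
  have hM0 : 0 ≤ M := (abs_nonneg _).trans hM
  have h1 : ∀ r, (p (τ + r) - p τ) ^ 2 ≤ 16 * r ^ 2 := by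
    intro r
    have e : p (τ + r) - p τ = B * (Real.cos (τ + r) - Real.cos τ)
        + C * (Real.sin (τ + r) - Real.sin τ) := by simp only [hpdef]; ring
    have := abs_mul_add_mul_le hB hC (c := Real.cos (τ + r) - Real.cos τ)
      (s := Real.sin (τ + r) - Real.sin τ) (r := |r|)
      (by simpa using Real.abs_cos_sub_cos_le (τ + r) τ)
      (by simpa using Real.abs_sin_sub_sin_le (τ + r) τ)
    rw [← e] at this
    rw [← sq_abs, ← sq_abs r]
    nlinarith [abs_nonneg (p (τ + r) - p τ), abs_nonneg r]
  -- The second difference of a sinusoid is `-2 (1 - cos s)` times that sinusoid, hence of order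
  -- `s²`.
  have h2 : |p (τ + s) + p (τ - s) - 2 * p τ| ≤ 4 * s ^ 2 := by
    have e : p (τ + s) + p (τ - s) - 2 * p τ
        = -(2 * (1 - Real.cos s)) * (B * Real.cos τ + C * Real.sin τ) := by
      simp only [hpdef, Real.cos_add, Real.sin_add, Real.cos_sub, Real.sin_sub]; ring
    rw [e, abs_mul, abs_neg, abs_of_nonneg (by linarith [Real.cos_le_one s])]
    have h3 := abs_mul_add_mul_le hB hC (Real.abs_cos_le_one τ) (Real.abs_sin_le_one τ)
    have h4 : 2 * (1 - Real.cos s) ≤ s ^ 2 := by linarith [Real.one_sub_sq_div_two_le_cos (x := s)]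
    calc _ ≤ s ^ 2 * (4 * 1) := mul_le_mul h4 h3 (abs_nonneg _) (sq_nonneg _)
      _ = _ := by ring
  have h5 := (abs_le.1 (hq _ (hp (τ + s)))).2
  have h6 := (abs_le.1 (hq _ (hp (τ - s)))).2
  have h7 : D (p τ) * (p (τ + s) + p (τ - s) - 2 * p τ) ≤ M * (4 * s ^ 2) := by
    refine (le_abs_self _).trans ?_
    rw [abs_mul]
    exact mul_le_mul hM h2 (abs_nonneg _) hM0
  have h8 := mul_le_mul_of_nonneg_left (h1 s) hM0
  have h9 := mul_le_mul_of_nonneg_left (h1 (-s)) hM0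
  rw [← sub_eq_add_neg] at h9
  change U (p (τ + s)) - U (p τ) - D (p τ) * (p (τ + s) - p τ) ≤ _ at h5
  change U (p (τ - s)) - U (p τ) - D (p τ) * (p (τ - s) - p τ) ≤ _ at h6
  -- `36 = 4 + 16 + 16`: the second difference of `p`, then the two Taylor remainders.
  nlinarith

/-- With at most one nonzero coefficient both sides have at most one term. This is how disjoint
gradients decouple the parameters `t k`. -/
theorem apply_sum_sub_eq_sum {ι : Type*} [Fintype ι] (h : ℝ → ℝ) (t c : ι → ℝ)
    (hc : ∀ k l, c k ≠ 0 → c l ≠ 0 → k = l) :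
    h (∑ k, t k * c k) - h 0 = ∑ k, (h (t k * c k) - h 0) := by
  by_cases h0 : ∃ k, c k ≠ 0
  · obtain ⟨k, hk⟩ := h0
    have hz : ∀ l, l ≠ k → c l = 0 := fun l hl => by
      by_contra h'
      exact hl (hc l k h' hk)
    rw [Finset.sum_eq_single k (fun l _ hl => by simp [hz l hl]) (by simp),
      Finset.sum_eq_single k (fun l _ hl => by simp [hz l hl]) (by simp)]
  · push Not at h0
    simp [h0]

/-! ### Rotated configurations and averages over rotations. -/

theorem abs_coord_le_one {n : ℕ} (v : SpinSphere n) (i : Fin n) :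
    |(v : EuclideanSpace ℝ (Fin n)) i| ≤ 1 := by
  have := PiLp.norm_apply_le (v : EuclideanSpace ℝ (Fin n)) i
  simpa using this

theorem inner_mem_Icc {n : ℕ} (v w : SpinSphere n) :
    inner ℝ (v : EuclideanSpace ℝ (Fin n)) w ∈ Set.Icc (-1 : ℝ) 1 := by
  rw [Set.mem_Icc, ← abs_le]
  simpa using abs_real_inner_le_norm (v : EuclideanSpace ℝ (Fin n)) (w : EuclideanSpace ℝ (Fin n))

/-- The energy of a configuration of spins along a finite family of edges. -/
noncomputable def edgeEnergy {V E : Type*} [Fintype E] (a b : E → V) {n : ℕ} (U : ℝ → ℝ)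
    (σ : V → SpinSphere n) : ℝ :=
  ∑ e, U (inner ℝ (σ (a e) : EuclideanSpace ℝ (Fin n)) (σ (b e)))

theorem continuous_edgeEnergy {V E : Type*} [Fintype E] (a b : E → V) {n : ℕ} {U : ℝ → ℝ}
    (hU : ContinuousOn U (Set.Icc (-1) 1)) :
    Continuous (edgeEnergy a b U : (V → SpinSphere n) → ℝ) := by
  refine continuous_finsetSum _ fun e _ => hU.comp_continuous ?_ fun σ => inner_mem_Icc _ _
  fun_prop

/-- The configuration obtained by rotating each spin `σ u` in the plane `(i, j)` by the angle
`∑ k, t k * φ k u`. -/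
noncomputable def rotateSpins {V ι : Type*} [Fintype ι] {n : ℕ} {i j : Fin n} (hij : i ≠ j)
    (φ : ι → V → ℝ) (t : ι → ℝ) (σ : V → SpinSphere n) : V → SpinSphere n :=
  fun u => sphereMap (planeRotation hij (∑ k, t k * φ k u)) (σ u)

theorem continuous_sphereMap_planeRotation {n : ℕ} {i j : Fin n} (hij : i ≠ j) :
    Continuous fun p : ℝ × SpinSphere n => sphereMap (planeRotation hij p.1) p.2 := by
  refine continuous_induced_rng.2 ?_
  have h : Continuous fun p : ℝ × SpinSphere n => (p.1, (p.2 : EuclideanSpace ℝ (Fin n))) := by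
    fun_prop
  have h2 := (continuous_planeRotation hij).comp h
  simp only [Function.comp_def, coe_sphereMap] at h2 ⊢
  exact h2

theorem continuous_rotateSpins {V ι : Type*} [Fintype ι] {n : ℕ} {i j : Fin n} (hij : i ≠ j)
    (φ : ι → V → ℝ) : Continuous fun p : (ι → ℝ) × (V → SpinSphere n) =>
      rotateSpins hij φ p.1 p.2 := by
  refine continuous_pi fun u => ?_
  have h : Continuous fun q : (ι → ℝ) × (V → SpinSphere n) => (∑ k, q.1 k * φ k u, q.2 u) := by
    fun_prop
  exact (continuous_sphereMap_planeRotation hij).comp h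

theorem isProbabilityMeasure_pi_uniformSphere (V : Type*) [Fintype V] {n : ℕ} (hn : 1 ≤ n) :
    IsProbabilityMeasure (Measure.pi fun _ : V => uniformSphere n) := by
  have := isProbabilityMeasure_uniformSphere hn
  infer_instance

theorem integral_rotateSpins {V ι : Type*} [Fintype V] [Fintype ι] {n : ℕ} (hn : 1 ≤ n)
    {i j : Fin n} (hij : i ≠ j) (φ : ι → V → ℝ) (t : ι → ℝ) {G : (V → SpinSphere n) → ℝ}
    (hG : Continuous G) :
    ∫ σ, G (rotateSpins hij φ t σ) ∂(Measure.pi fun _ : V => uniformSphere n)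
      = ∫ σ, G σ ∂(Measure.pi fun _ : V => uniformSphere n) := by
  have := isProbabilityMeasure_uniformSphere hn
  have hm : MeasurePreserving (rotateSpins hij φ t) (Measure.pi fun _ : V => uniformSphere n)
      (Measure.pi fun _ : V => uniformSphere n) :=
    measurePreserving_pi _ _ fun u => measurePreserving_sphereMap_uniformSphere _
  rw [← hm.map_eq, integral_map hm.measurable.aemeasurable hG.aestronglyMeasurable, hm.map_eq]

theorem integrable_rotateSpins {V ι : Type*} [Fintype V] [Fintype ι] {n : ℕ} (hn : 1 ≤ n)
    {i j : Fin n} (hij : i ≠ j) (φ : ι → V → ℝ) {G : (V → SpinSphere n) → ℝ}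
    (hG : Continuous G) (ν : Measure (ι → ℝ)) [IsFiniteMeasure ν] :
    Integrable (Function.uncurry fun σ t => G (rotateSpins hij φ t σ))
      ((Measure.pi fun _ : V => uniformSphere n).prod ν) := by
  have := isProbabilityMeasure_pi_uniformSphere V hn
  obtain ⟨B, hB⟩ := isCompact_univ.exists_bound_of_continuousOn hG.continuousOn
  refine Integrable.of_bound (C := B) ?_ (Filter.Eventually.of_forall fun p => hB _ trivial)
  refine Continuous.aestronglyMeasurable ?_
  exact hG.comp ((continuous_rotateSpins hij φ).comp continuous_swap)

/-- Averaging over all rotations does not change the integral of an observable. -/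
theorem integral_integral_rotateSpins {V ι : Type*} [Fintype V] [Fintype ι] {n : ℕ} (hn : 1 ≤ n)
    {i j : Fin n} (hij : i ≠ j) (φ : ι → V → ℝ) {G : (V → SpinSphere n) → ℝ}
    (hG : Continuous G) (ν : Measure (ι → ℝ)) [IsFiniteMeasure ν] :
    ∫ σ, ∫ t, G (rotateSpins hij φ t σ) ∂ν ∂(Measure.pi fun _ : V => uniformSphere n)
      = ν.real Set.univ * ∫ σ, G σ ∂(Measure.pi fun _ : V => uniformSphere n) := by
  have := isProbabilityMeasure_pi_uniformSphere V hn
  rw [integral_integral_swap (integrable_rotateSpins hn hij φ hG ν)]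
  simp [integral_rotateSpins hn hij φ _ hG]

/-! ### Energy change under a rotation of the spins. -/

/-- The inner product of `v` and `w` after rotating `v` relative to `w` by the angle `τ`. -/
noncomputable def rotatedInner {n : ℕ} (i j : Fin n) (v w : SpinSphere n) (τ : ℝ) : ℝ :=
  inner ℝ (v : EuclideanSpace ℝ (Fin n)) w
    + ((v.1 i * w.1 i + v.1 j * w.1 j) * (Real.cos τ - 1)
      + (v.1 i * w.1 j - v.1 j * w.1 i) * Real.sin τ)

theorem inner_sphereMap_planeRotation {n : ℕ} {i j : Fin n} (hij : i ≠ j) (v w : SpinSphere n)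
    (α β : ℝ) : inner ℝ (sphereMap (planeRotation hij α) v : EuclideanSpace ℝ (Fin n))
      (sphereMap (planeRotation hij β) w) = rotatedInner i j v w (α - β) :=
  inner_planeRotation hij α β v w

theorem rotatedInner_mem_Icc {n : ℕ} {i j : Fin n} (hij : i ≠ j) (v w : SpinSphere n) (τ : ℝ) :
    rotatedInner i j v w τ ∈ Set.Icc (-1 : ℝ) 1 := by
  rw [← sub_zero τ, ← inner_sphereMap_planeRotation hij]
  exact inner_mem_Icc _ _

theorem continuous_rotatedInner {n : ℕ} (i j : Fin n) (v w : SpinSphere n) :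
    Continuous (rotatedInner i j v w) := by
  unfold rotatedInner
  fun_prop

theorem rotatedInner_second_difference_le {U D : ℝ → ℝ} {M : ℝ}
    (hD : ∀ p ∈ Set.Icc (-1 : ℝ) 1, |D p| ≤ M ∧
      ∀ q ∈ Set.Icc (-1 : ℝ) 1, |U q - U p - D p * (q - p)| ≤ M * (q - p) ^ 2)
    {n : ℕ} {i j : Fin n} (hij : i ≠ j) (v w : SpinSphere n) (τ s : ℝ) :
    U (rotatedInner i j v w (τ + s)) + U (rotatedInner i j v w (τ - s))
      - 2 * U (rotatedInner i j v w τ) ≤ 36 * M * s ^ 2 := by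
  have hc : ∀ (a b c d : Fin n), |v.1 a * w.1 b| + |v.1 c * w.1 d| ≤ 2 := fun a b c d => by
    rw [abs_mul, abs_mul]
    linarith [mul_le_one₀ (abs_coord_le_one v a) (abs_nonneg _) (abs_coord_le_one w b),
      mul_le_one₀ (abs_coord_le_one v c) (abs_nonneg _) (abs_coord_le_one w d)]
  exact second_difference_le hD ((abs_add_le _ _).trans (hc _ _ _ _))
    ((abs_sub _ _).trans (hc _ _ _ _)) (rotatedInner_mem_Icc hij v w) τ s

/-- The change of the energy under the rotation of the spins by the angles `t * c`, where `c e` is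
the difference of angles across the edge `e`. -/
noncomputable def energyShift {V E : Type*} [Fintype E] (a b : E → V) {n : ℕ} (i j : Fin n)
    (U : ℝ → ℝ) (σ : V → SpinSphere n) (c : E → ℝ) (t : ℝ) : ℝ :=
  ∑ e, (U (rotatedInner i j (σ (a e)) (σ (b e)) (t * c e))
    - U (rotatedInner i j (σ (a e)) (σ (b e)) 0))

theorem continuous_energyShift {V E : Type*} [Fintype E] (a b : E → V) {n : ℕ} {i j : Fin n}
    (hij : i ≠ j) {U : ℝ → ℝ} (hU : ContinuousOn U (Set.Icc (-1) 1)) (σ : V → SpinSphere n)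
    (c : E → ℝ) : Continuous (energyShift a b i j U σ c) := by
  refine continuous_finsetSum _ fun e _ => Continuous.sub
    (hU.comp_continuous ?_ fun t => rotatedInner_mem_Icc hij _ _ _) continuous_const
  exact (continuous_rotatedInner i j _ _).comp (by fun_prop)

/-- When `c e * N` is an integer, advancing `t` by `2πN` turns every edge by whole revolutions.
Rational cutoffs thus give a compact range of `t` to average over. -/
theorem energyShift_periodic {V E : Type*} [Fintype E] (a b : E → V) {n : ℕ} (i j : Fin n)
    (U : ℝ → ℝ) (σ : V → SpinSphere n) {c : E → ℝ} {N : ℕ} (hc : ∀ e, ∃ m : ℤ, c e * N = m) :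
    Function.Periodic (energyShift a b i j U σ c) (2 * Real.pi * N) := by
  intro t
  refine Finset.sum_congr rfl fun e _ => ?_
  obtain ⟨m, hm⟩ := hc e
  have h : (t + 2 * Real.pi * N) * c e = t * c e + m * (2 * Real.pi) := by rw [← hm]; ring
  simp only [rotatedInner, h, Real.cos_add_int_mul_two_pi, Real.sin_add_int_mul_two_pi]

/-- An edge with angle increment `s * c e` costs `36 M (s * c e)²`; the sum is the Dirichlet energy.
-/
theorem energyShift_second_difference_le {U D : ℝ → ℝ} {M : ℝ}
    (hD : ∀ p ∈ Set.Icc (-1 : ℝ) 1, |D p| ≤ M ∧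
      ∀ q ∈ Set.Icc (-1 : ℝ) 1, |U q - U p - D p * (q - p)| ≤ M * (q - p) ^ 2)
    {V E : Type*} [Fintype E] (a b : E → V) {n : ℕ} {i j : Fin n} (hij : i ≠ j)
    (σ : V → SpinSphere n) {c : E → ℝ} {S : ℝ} (hM : 0 ≤ M) (hS : ∑ e, c e ^ 2 ≤ S) (t s : ℝ) :
    energyShift a b i j U σ c (t + s) + energyShift a b i j U σ c (t - s)
      - 2 * energyShift a b i j U σ c t ≤ 36 * M * s ^ 2 * S := by
  refine le_trans ?_ (mul_le_mul_of_nonneg_left hS (by positivity))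
  rw [energyShift, energyShift, energyShift, Finset.mul_sum, Finset.mul_sum,
    ← Finset.sum_add_distrib, ← Finset.sum_sub_distrib]
  refine Finset.sum_le_sum fun e _ => ?_
  have := rotatedInner_second_difference_le hD hij (σ (a e)) (σ (b e)) (t * c e) (s * c e)
  rw [← add_mul, ← sub_mul] at this
  linarith

theorem edgeEnergy_rotateSpins {V E ι : Type*} [Fintype E] [Fintype ι] (a b : E → V) {n : ℕ}
    {i j : Fin n} (hij : i ≠ j) (U : ℝ → ℝ) {φ : ι → V → ℝ}
    (hφ : ∀ e k l, φ k (a e) ≠ φ k (b e) → φ l (a e) ≠ φ l (b e) → k = l)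
    (t : ι → ℝ) (σ : V → SpinSphere n) :
    edgeEnergy a b U (rotateSpins hij φ t σ) = edgeEnergy a b U σ
      + ∑ k, energyShift a b i j U σ (fun e => φ k (a e) - φ k (b e)) (t k) := by
  simp only [energyShift]
  rw [Finset.sum_comm, edgeEnergy, edgeEnergy, ← Finset.sum_add_distrib]
  refine Finset.sum_congr rfl fun e _ => ?_
  have h := apply_sum_sub_eq_sum (fun τ => U (rotatedInner i j (σ (a e)) (σ (b e)) τ)) t
    (fun k => φ k (a e) - φ k (b e)) fun k l hk hl =>
      hφ e k l (sub_ne_zero.1 hk) (sub_ne_zero.1 hl)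
  rw [← h]
  simp only [rotateSpins]
  rw [inner_sphereMap_planeRotation, ← Finset.sum_sub_distrib]
  simp only [mul_sub]
  have h0 : rotatedInner i j (σ (a e)) (σ (b e)) 0
      = inner ℝ (σ (a e) : EuclideanSpace ℝ (Fin n)) (σ (b e)) := by simp [rotatedInner]
  rw [h0]
  ring

/-! ### Decay of correlations from independent angles. -/

/-- Character and weight both factor over `k`, so Fubini turns the integral into a product of
one-variable integrals, each gaining a factor `q`. -/
theorem integral_exp_neg_mul_prod_re_le {ι : Type*} [Fintype ι] {f : ι → ℝ → ℝ}
    (hf : ∀ k, Continuous (f k)) (z : ℂ) {P q : ℝ} (hP : 0 ≤ P)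
    (hq : ∀ k, ‖∫ t in (0 : ℝ)..P, Complex.exp (t * Complex.I) * (Real.exp (-f k t) : ℝ)‖
      ≤ q * ∫ t in (0 : ℝ)..P, Real.exp (-f k t)) :
    |∫ t : ι → ℝ, (Complex.exp ((∑ k, t k : ℝ) * Complex.I) * z).re * Real.exp (-∑ k, f k (t k))
      ∂(Measure.pi fun _ => volume.restrict (Set.Ioc 0 P))|
    ≤ ‖z‖ * q ^ Fintype.card ι * ∫ t : ι → ℝ, Real.exp (-∑ k, f k (t k))
      ∂(Measure.pi fun _ => volume.restrict (Set.Ioc 0 P)) := by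
  set ν : Measure ℝ := volume.restrict (Set.Ioc 0 P)
  set g : ι → ℝ → ℂ := fun k t => Complex.exp (t * Complex.I) * (Real.exp (-f k t) : ℝ) with hg
  have hgi : ∀ k, Integrable (g k) ν := fun k => by
    have : Continuous (g k) := by
      have := hf k
      fun_prop
    exact (this.integrableOn_Icc).mono_set Set.Ioc_subset_Icc_self
  have e1 : ∀ t : ι → ℝ, (Complex.exp ((∑ k, t k : ℝ) * Complex.I) * z).re
      * Real.exp (-∑ k, f k (t k)) = RCLike.re (z * ∏ k, g k (t k)) := fun t => by
    have : ∏ k, g k (t k) = Complex.exp ((∑ k, t k : ℝ) * Complex.I)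
        * (Real.exp (-∑ k, f k (t k)) : ℝ) := by
      simp only [hg, Finset.prod_mul_distrib]
      rw [← Complex.exp_sum, ← Complex.ofReal_prod, ← Real.exp_sum, Finset.sum_neg_distrib,
        Complex.ofReal_sum, Finset.sum_mul]
    rw [this, ← mul_assoc, RCLike.re_eq_complex_re, Complex.re_mul_ofReal, mul_comm z]
  have e2 : ∀ t : ι → ℝ, Real.exp (-∑ k, f k (t k)) = ∏ k, Real.exp (-f k (t k)) := fun t => by
    rw [← Real.exp_sum, Finset.sum_neg_distrib]
  simp_rw [e1]
  simp only [e2]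
  rw [integral_re ((Integrable.fintype_prod hgi).const_mul z), integral_const_mul,
    integral_fintype_prod_eq_prod, integral_fintype_prod_eq_prod (f := fun k t => Real.exp (-f k t))]
  refine (RCLike.abs_re_le_norm _).trans ?_
  rw [norm_mul, norm_prod, mul_assoc]
  refine mul_le_mul_of_nonneg_left ?_ (norm_nonneg _)
  rw [← Finset.card_univ, ← Finset.prod_const, ← Finset.prod_mul_distrib]
  refine Finset.prod_le_prod (fun _ _ => norm_nonneg _) fun k _ => ?_
  have := hq k
  rwa [intervalIntegral.integral_of_le hP, intervalIntegral.integral_of_le hP] at this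

theorem abs_integral_coord_mul_coord_le {U D : ℝ → ℝ} {M : ℝ} (hM : 0 ≤ M)
    (hU : ContinuousOn U (Set.Icc (-1) 1))
    (hD : ∀ p ∈ Set.Icc (-1 : ℝ) 1, |D p| ≤ M ∧
      ∀ q ∈ Set.Icc (-1 : ℝ) 1, |U q - U p - D p * (q - p)| ≤ M * (q - p) ^ 2)
    {V E ι : Type*} [Fintype V] [Fintype E] [Fintype ι] (a b : E → V) {n : ℕ}
    {i j : Fin n} (hij : i ≠ j) {φ : ι → V → ℝ}
    (hφ : ∀ e k l, φ k (a e) ≠ φ k (b e) → φ l (a e) ≠ φ l (b e) → k = l)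
    {N : ℕ} (hN : 0 < N) (hint : ∀ k u, ∃ m : ℤ, φ k u * N = m)
    {S : ℝ} (hS0 : 0 ≤ S) (hS : ∀ k, ∑ e, (φ k (a e) - φ k (b e)) ^ 2 ≤ S) {x y : V}
    (hx : ∀ k, φ k x = 1) (hy : ∀ k, φ k y = 0) :
    |∫ σ, (σ x).1 i * (σ y).1 i * Real.exp (-edgeEnergy a b U σ)
        ∂(Measure.pi fun _ : V => uniformSphere n)|
      ≤ 2 * (1 - 1 / (2 * Real.exp (36 * M * (Real.pi / 2) ^ 2 * S))) ^ Fintype.card ι *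
        ∫ σ, Real.exp (-edgeEnergy a b U σ) ∂(Measure.pi fun _ : V => uniformSphere n) := by
  have hn : 1 ≤ n := Nat.one_le_of_lt i.isLt
  set μ := Measure.pi fun _ : V => uniformSphere n
  set Q := 36 * M * (Real.pi / 2) ^ 2 * S
  set q := 1 - 1 / (2 * Real.exp Q)
  set P := 2 * Real.pi * N
  have hP : 0 < P := by positivity
  set ν : Measure (ι → ℝ) := Measure.pi fun _ => volume.restrict (Set.Ioc 0 P) with hν
  have hνpos : 0 < ν.real Set.univ := by
    rw [hν, measureReal_def, Measure.pi_univ]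
    simp [hP.le]
    positivity
  have hH := continuous_edgeEnergy (n := n) a b hU
  have hW : Continuous fun σ : V → SpinSphere n => Real.exp (-edgeEnergy a b U σ) := by fun_prop
  have hG : Continuous fun σ : V → SpinSphere n =>
      (σ x).1 i * (σ y).1 i * Real.exp (-edgeEnergy a b U σ) := by fun_prop
  set f : (V → SpinSphere n) → ι → ℝ → ℝ := fun σ k =>
    energyShift a b i j U σ fun e => φ k (a e) - φ k (b e) with hf
  have hfc : ∀ σ k, Continuous (f σ k) := fun σ k => continuous_energyShift a b hij hU σ _
  have hfq : ∀ σ k, ‖∫ t in (0 : ℝ)..P, Complex.exp (t * Complex.I) * (Real.exp (-f σ k t) : ℝ)‖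
      ≤ q * ∫ t in (0 : ℝ)..P, Real.exp (-f σ k t) := by
    intro σ k
    refine norm_integral_exp_mul_le ?_ (fun t => Real.exp_pos _) ?_ (Real.exp_pos Q) ?_
    · have := hfc σ k
      fun_prop
    · intro t
      have := energyShift_periodic a b i j U σ (c := fun e => φ k (a e) - φ k (b e)) (N := N)
        (fun e => by
          obtain ⟨m, hm⟩ := hint k (a e)
          obtain ⟨m', hm'⟩ := hint k (b e)
          exact ⟨m - m', by push_cast; rw [sub_mul, hm, hm']⟩) t
      simp only [hf]
      rw [this]
    · intro t
      -- After taking logarithms, the hypothesis on the weight is the second-difference bound at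
      -- step `π/2`.
      rw [sq, ← Real.exp_add, ← Real.exp_add, ← Real.exp_add, Real.exp_le_exp]
      have := energyShift_second_difference_le hD a b hij σ hM (hS k) t (Real.pi / 2)
      change _ ≤ Q at this
      simp only [hf]
      linarith
  have key : ∀ σ, |∫ t, (fun σ : V → SpinSphere n =>
      (σ x).1 i * (σ y).1 i * Real.exp (-edgeEnergy a b U σ)) (rotateSpins hij φ t σ) ∂ν|
      ≤ 2 * q ^ Fintype.card ι *
        ∫ t, (fun σ : V → SpinSphere n => Real.exp (-edgeEnergy a b U σ))
          (rotateSpins hij φ t σ) ∂ν := by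
    intro σ
    -- The plane `(i, j)` is read as `ℂ`: rotating the spin at `x` multiplies `z` by a unit
    -- character, while the factor at `y` is fixed since every `φ k` vanishes there.
    set z : ℂ := (σ y).1 i * ⟨(σ x).1 i, (σ x).1 j⟩ with hz
    have hz2 : ‖z‖ ≤ 2 := by
      rw [hz, norm_mul, Complex.norm_real, Real.norm_eq_abs]
      have h1 := Complex.norm_le_abs_re_add_abs_im ⟨(σ x).1 i, (σ x).1 j⟩
      have h2 := abs_coord_le_one (σ x) i
      have h3 := abs_coord_le_one (σ x) j
      calc _ ≤ 1 * (2 : ℝ) := mul_le_mul (abs_coord_le_one _ _) (h1.trans (by simp only; linarith))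
            (norm_nonneg _) zero_le_one
        _ = 2 := one_mul 2
    have hxr : ∀ t, (rotateSpins hij φ t σ x).1 i = Real.cos (∑ k, t k) * (σ x).1 i
        - Real.sin (∑ k, t k) * (σ x).1 j := fun t => by
      have h := planeRotation_apply_left hij (∑ k, t k) (σ x).1
      simp only [rotateSpins, hx, mul_one, coe_sphereMap]
      exact h
    have hyr : ∀ t, (rotateSpins hij φ t σ y).1 i = (σ y).1 i := fun t => by
      simp only [rotateSpins, hy, mul_zero, Finset.sum_const_zero, coe_sphereMap,
        planeRotation_zero]
    have e1 : ∀ t, (rotateSpins hij φ t σ x).1 i * (rotateSpins hij φ t σ y).1 i *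
        Real.exp (-edgeEnergy a b U (rotateSpins hij φ t σ)) = Real.exp (-edgeEnergy a b U σ) *
        ((Complex.exp ((∑ k, t k : ℝ) * Complex.I) * z).re * Real.exp (-∑ k, f σ k (t k))) := by
      intro t
      rw [hxr, hyr, edgeEnergy_rotateSpins a b hij U hφ, neg_add, Real.exp_add]
      have : (Complex.exp ((∑ k, t k : ℝ) * Complex.I) * z).re
          = (Real.cos (∑ k, t k) * (σ x).1 i - Real.sin (∑ k, t k) * (σ x).1 j) * (σ y).1 i := by
        rw [hz, Complex.mul_re, Complex.exp_ofReal_mul_I_re, Complex.exp_ofReal_mul_I_im,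
          Complex.re_ofReal_mul, Complex.im_ofReal_mul]
        ring
      rw [this]
      ring
    have e2 : ∀ t, Real.exp (-edgeEnergy a b U (rotateSpins hij φ t σ))
        = Real.exp (-edgeEnergy a b U σ) * Real.exp (-∑ k, f σ k (t k)) := by
      intro t
      rw [edgeEnergy_rotateSpins a b hij U hφ, neg_add, Real.exp_add]
    simp_rw [e1]
    simp only [e2]
    rw [integral_const_mul, integral_const_mul, abs_mul, abs_of_pos (Real.exp_pos _),
      mul_left_comm]
    refine mul_le_mul_of_nonneg_left ?_ (Real.exp_pos _).le
    refine (integral_exp_neg_mul_prod_re_le (hfc σ) z hP.le (hfq σ)).trans ?_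
    have hq0 : 0 ≤ q := by
      have h1 : 1 ≤ Real.exp Q := Real.one_le_exp (by positivity)
      exact sub_nonneg.2 ((div_le_one (by positivity)).2 (by linarith))
    refine mul_le_mul_of_nonneg_right ?_ (integral_nonneg fun t => (Real.exp_pos _).le)
    exact mul_le_mul_of_nonneg_right hz2 (pow_nonneg hq0 _)
  -- Multiply by the total mass of `ν` and replace both integrals by their averages over rotations;
  -- the bound `key` then holds for each `σ`.
  rw [← mul_le_mul_iff_right₀ hνpos, ← abs_of_pos hνpos, ← abs_mul, abs_of_pos hνpos,
    ← integral_integral_rotateSpins hn hij φ hG ν, mul_left_comm,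
    ← integral_integral_rotateSpins hn hij φ hW ν, ← integral_const_mul]
  have := isProbabilityMeasure_pi_uniformSphere V hn
  have hI : Integrable (fun σ => ∫ t, (fun σ : V → SpinSphere n =>
      Real.exp (-edgeEnergy a b U σ)) (rotateSpins hij φ t σ) ∂ν) μ :=
    (integrable_rotateSpins hn hij φ hW ν).integral_prod_left
  rw [← Real.norm_eq_abs]
  refine norm_integral_le_of_norm_le (hI.const_mul _) ?_
  exact Filter.Eventually.of_forall key

/-! ### The spin model on a finite graph. -/

theorem integrable_of_continuous_spins {V : Type*} [Fintype V] {n : ℕ} (hn : 1 ≤ n)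
    {G : (V → SpinSphere n) → ℝ} (hG : Continuous G) :
    Integrable G (Measure.pi fun _ : V => uniformSphere n) := by
  have := isProbabilityMeasure_pi_uniformSphere V hn
  obtain ⟨B, hB⟩ := isCompact_univ.exists_bound_of_continuousOn hG.continuousOn
  exact Integrable.of_bound hG.aestronglyMeasurable B
    (Filter.Eventually.of_forall fun p => hB _ trivial)

/-- `Quot.out` orients each edge arbitrarily; symmetry of the inner product makes the choice
harmless. -/
theorem spinEnergy_eq_edgeEnergy {V : Type*} (G : SimpleGraph V) [Fintype G.edgeSet] {n : ℕ}
    (U : ℝ → ℝ) (σ : V → SpinSphere n) : spinEnergy G n U σ =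
      edgeEnergy (fun e : G.edgeSet => (Quot.out e.1).1) (fun e => (Quot.out e.1).2) U σ := by
  rw [spinEnergy, edgeEnergy, ← Finset.sum_coe_sort]
  refine Fintype.sum_equiv (Equiv.subtypeEquivRight fun e => by simp) _ _ fun e => ?_
  conv_lhs => rw [← Quot.out_eq e.1]
  rfl

theorem adj_out {V : Type*} (G : SimpleGraph V) (e : G.edgeSet) :
    G.Adj (Quot.out e.1).1 (Quot.out e.1).2 := by
  rw [← SimpleGraph.mem_edgeSet]
  have : s((Quot.out e.1).1, (Quot.out e.1).2) = e.1 := Quot.out_eq e.1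
  rw [this]
  exact e.2

/-- Correlations decay exponentially in the number of cutoff functions with disjoint gradients and
bounded Dirichlet energy that separate the two vertices. -/
theorem abs_spinCorrelation_le {U D : ℝ → ℝ} {M : ℝ} (hM : 0 ≤ M)
    (hU : ContinuousOn U (Set.Icc (-1) 1))
    (hD : ∀ p ∈ Set.Icc (-1 : ℝ) 1, |D p| ≤ M ∧
      ∀ q ∈ Set.Icc (-1 : ℝ) 1, |U q - U p - D p * (q - p)| ≤ M * (q - p) ^ 2)
    {V ι : Type*} [Fintype V] [Fintype ι] (G : SimpleGraph V) [Fintype G.edgeSet] {n : ℕ}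
    (hn : 2 ≤ n) {φ : ι → V → ℝ}
    (hφ : ∀ u v, G.Adj u v → ∀ k l, φ k u ≠ φ k v → φ l u ≠ φ l v → k = l)
    {N : ℕ} (hN : 0 < N) (hint : ∀ k u, ∃ m : ℤ, φ k u * N = m)
    {S : ℝ} (hS0 : 0 ≤ S)
    (hS : ∀ k, ∑ e : G.edgeSet, (φ k (Quot.out e.1).1 - φ k (Quot.out e.1).2) ^ 2 ≤ S) {x y : V}
    (hx : ∀ k, φ k x = 1) (hy : ∀ k, φ k y = 0) :
    |spinCorrelation G n U x y|
      ≤ 2 * n * (1 - 1 / (2 * Real.exp (36 * M * (Real.pi / 2) ^ 2 * S))) ^ Fintype.card ι := by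
  set q := 1 - 1 / (2 * Real.exp (36 * M * (Real.pi / 2) ^ 2 * S)) with hq
  have hq0 : 0 ≤ q := by
    have h1 : 1 ≤ Real.exp (36 * M * (Real.pi / 2) ^ 2 * S) := Real.one_le_exp (by positivity)
    exact sub_nonneg.2 ((div_le_one (by positivity)).2 (by linarith))
  have : Nontrivial (Fin n) := Fin.nontrivial_iff_two_le.2 hn
  set a : G.edgeSet → V := fun e => (Quot.out e.1).1
  set b : G.edgeSet → V := fun e => (Quot.out e.1).2
  have hH := continuous_edgeEnergy (n := n) a b hU
  set Z := ∫ σ, Real.exp (-edgeEnergy a b U σ) ∂(Measure.pi fun _ : V => uniformSphere n)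
  have hZ : 0 ≤ Z := integral_nonneg fun σ => (Real.exp_pos _).le
  have hterm : ∀ l : Fin n, |∫ σ, (σ x).1 l * (σ y).1 l * Real.exp (-edgeEnergy a b U σ)
      ∂(Measure.pi fun _ : V => uniformSphere n)| ≤ 2 * q ^ Fintype.card ι * Z := fun l => by
    -- Here `n ≥ 2` enters: coordinate `l` needs a partner to rotate with.
    obtain ⟨j, hj⟩ := exists_ne l
    exact abs_integral_coord_mul_coord_le hM hU hD a b hj.symm
      (fun e k l => hφ _ _ (adj_out G e) k l) hN hint hS0 hS hx hy
  have e1 : spinCorrelation G n U x y = Z⁻¹ * ∑ l, ∫ σ, (σ x).1 l * (σ y).1 l *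
      Real.exp (-edgeEnergy a b U σ) ∂(Measure.pi fun _ : V => uniformSphere n) := by
    rw [spinCorrelation, spinMeasure, integral_tilted, ← integral_finsetSum, ← integral_const_mul]
    · refine integral_congr_ae (Filter.Eventually.of_forall fun σ => ?_)
      simp only [spinEnergy_eq_edgeEnergy, PiLp.inner_apply, RCLike.inner_apply, conj_trivial,
        smul_eq_mul]
      rw [← Finset.sum_mul]
      simp only [mul_comm ((σ x).1 _)]
      change _ / Z * _ = _
      ring
    · intro l _
      exact integrable_of_continuous_spins (by omega) (by fun_prop)
  rw [e1, abs_mul, abs_of_nonneg (inv_nonneg.2 hZ)]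
  calc _ ≤ Z⁻¹ * ∑ _l : Fin n, 2 * q ^ Fintype.card ι * Z := by
        refine mul_le_mul_of_nonneg_left ?_ (inv_nonneg.2 hZ)
        exact (Finset.abs_sum_le_sum_abs _ _).trans (Finset.sum_le_sum fun l _ => hterm l)
    _ = 2 * n * q ^ Fintype.card ι * (Z⁻¹ * Z) := by
        rw [Finset.sum_const, Finset.card_univ, Fintype.card_fin, nsmul_eq_mul]; ring
    _ ≤ _ := mul_le_of_le_one_right (by positivity) (inv_mul_le_one)

/-! ### Connectivity and volume growth of the torus. -/

theorem torusGraph_adj_update {d L : ℕ} (u : TorusVertex d L) (i : Fin d)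
    {z w : Finset.Ioc (-(L : ℤ)) (L : ℤ)} (h : (w : ℤ) = z + 1) :
    (torusGraph d L).Adj (Function.update u i w) (Function.update u i z) := by
  refine ⟨i, fun j hj => by simp [hj], Or.inl ?_⟩
  simp [h]

theorem torusGraph_reachable_update {d L : ℕ} (u : TorusVertex d L) (i : Fin d)
    (w : Finset.Ioc (-(L : ℤ)) (L : ℤ)) :
    (torusGraph d L).Reachable u (Function.update u i w) := by
  have key : ∀ m : ℕ, ∀ z z' : Finset.Ioc (-(L : ℤ)) (L : ℤ), (z' : ℤ) = z + m →
      (torusGraph d L).Reachable (Function.update u i z') (Function.update u i z) := by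
    intro m
    induction m with
    | zero =>
      intro z z' h
      have : z' = z := Subtype.ext (by simpa using h)
      rw [this]
    | succ m ih =>
      intro z z' h
      have hz := Finset.mem_Ioc.1 z.2
      have hz' := Finset.mem_Ioc.1 z'.2
      push_cast at h
      let w : Finset.Ioc (-(L : ℤ)) (L : ℤ) :=
        ⟨z + m, Finset.mem_Ioc.2 ⟨by omega, by omega⟩⟩
      have hw : (z' : ℤ) = w + 1 := by simp only [w]; omega
      exact (torusGraph_adj_update u i hw).reachable.trans (ih z w rfl)
  have h : ∀ z z', (torusGraph d L).Reachable (Function.update u i z') (Function.update u i z) := by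
    intro z z'
    rcases le_total (z : ℤ) z' with h | h
    · exact key ((z' : ℤ) - z).toNat z z' (by omega)
    · exact (key ((z : ℤ) - z').toNat z' z (by omega)).symm
  simpa using h w (u i)

/-- `SimpleGraph.dist` is `0` by default on unreachable pairs; connectivity excludes this, so
distinct vertices have positive distance. -/
theorem torusGraph_reachable {L : ℕ} (u v : TorusVertex 2 L) : (torusGraph 2 L).Reachable u v := by
  have h : Function.update (Function.update u 0 (v 0)) 1 (v 1) = v := by
    ext j
    fin_cases j <;> simp
  have h1 := torusGraph_reachable_update u 0 (v 0)
  have h2 := torusGraph_reachable_update (Function.update u 0 (v 0)) 1 (v 1)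
  rw [h] at h2
  exact h1.trans h2

/-- The residues modulo `2L` of the two coordinates of a vertex of the torus. -/
def torusResidue {L : ℕ} (u : TorusVertex 2 L) : ZMod (2 * L) × ZMod (2 * L) :=
  (((u 0 : ℤ) : ZMod (2 * L)), ((u 1 : ℤ) : ZMod (2 * L)))

theorem torusResidue_injective {L : ℕ} : Function.Injective (torusResidue (L := L)) := by
  intro u v h
  have key : ∀ z w : Finset.Ioc (-(L : ℤ)) (L : ℤ),
      ((z : ℤ) : ZMod (2 * L)) = ((w : ℤ) : ZMod (2 * L)) →
      z = w := by
    intro z w h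
    rw [ZMod.intCast_eq_intCast_iff, Int.modEq_iff_dvd] at h
    obtain ⟨c, hc⟩ := h
    have hz := Finset.mem_Ioc.1 z.2
    have hw := Finset.mem_Ioc.1 w.2
    push_cast at hc
    refine Subtype.ext ?_
    have h1 : (2 * L : ℤ) * c < 2 * L * 1 := by omega
    have h2 : (2 * L : ℤ) * (-1) < 2 * L * c := by omega
    have hL : (0 : ℤ) < 2 * L := by omega
    have h3 := lt_of_mul_lt_mul_left h1 hL.le
    have h4 := lt_of_mul_lt_mul_left h2 hL.le
    have : c = 0 := by omega
    rw [this] at hc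
    omega
  ext j
  rw [torusResidue, torusResidue, Prod.mk.injEq] at h
  fin_cases j
  · exact congrArg Subtype.val (key _ _ h.1)
  · exact congrArg Subtype.val (key _ _ h.2)

/-- The four unit steps of the square lattice. -/
def unitSteps : Finset (ℤ × ℤ) := {(1, 0), (-1, 0), (0, 1), (0, -1)}

theorem exists_unitStep_of_adj {L : ℕ} {u v : TorusVertex 2 L} (h : (torusGraph 2 L).Adj u v) :
    ∃ o ∈ unitSteps, torusResidue v = torusResidue u +
      (((o.1 : ℤ) : ZMod (2 * L)), ((o.2 : ℤ) : ZMod (2 * L))) := by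
  obtain ⟨i, hi, h⟩ := h
  have e : ∀ z w : ℤ, z - w ≡ 1 [ZMOD 2 * L] →
      (z : ZMod (2 * L)) = (w : ZMod (2 * L)) + 1 := by
    intro z w hzw
    have := (ZMod.intCast_eq_intCast_iff (z - w) 1 (2 * L)).2 (by exact_mod_cast hzw)
    push_cast at this
    rw [← this]; ring
  fin_cases i
  · have h1 := hi 1 (by decide)
    rcases h with h | h
    · refine ⟨(-1, 0), by decide, ?_⟩
      have := e _ _ h
      simp only [Fin.zero_eta] at this
      simp [torusResidue, h1, this]
    · refine ⟨(1, 0), by decide, ?_⟩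
      have := e _ _ h
      simp only [Fin.zero_eta] at this
      simp [torusResidue, h1, this]
  · have h1 := hi 0 (by decide)
    rcases h with h | h
    · refine ⟨(0, -1), by decide, ?_⟩
      have := e _ _ h
      simp only [Fin.mk_one] at this
      simp [torusResidue, h1, this]
    · refine ⟨(0, 1), by decide, ?_⟩
      have := e _ _ h
      simp only [Fin.mk_one] at this
      simp [torusResidue, h1, this]

/-- Lifts a walk to `ℤ²`, so balls can be counted there whether or not they wrap around the torus.
-/
theorem exists_displacement_of_walk {L : ℕ} {u v : TorusVertex 2 L}
    (p : (torusGraph 2 L).Walk u v) :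
    ∃ o : ℤ × ℤ, |o.1| ≤ p.length ∧ |o.2| ≤ p.length ∧
      torusResidue v = torusResidue u + (((o.1 : ℤ) : ZMod (2 * L)), ((o.2 : ℤ) : ZMod (2 * L))) := by
  induction p with
  | nil => exact ⟨0, by simp⟩
  | cons h p ih =>
    obtain ⟨o, h1, h2, h3⟩ := ih
    obtain ⟨s, hs, h4⟩ := exists_unitStep_of_adj h
    have hs' : |s.1| ≤ 1 ∧ |s.2| ≤ 1 := by
      revert s
      unfold unitSteps
      simp
    refine ⟨s + o, ?_, ?_, ?_⟩
    · rw [SimpleGraph.Walk.length_cons, Prod.fst_add]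
      push_cast
      linarith [abs_add_le s.1 o.1]
    · rw [SimpleGraph.Walk.length_cons, Prod.snd_add]
      push_cast
      linarith [abs_add_le s.2 o.2]
    · rw [h3, h4]
      ext <;> simp [add_assoc]

/-- A nearby oriented edge is determined by the displacement of its first endpoint, in a box of side
`2R + 1`, and one of four unit steps. Quadratic growth is where dimension two enters. -/
theorem card_edges_near_le {L : ℕ} (x : TorusVertex 2 L) (R : ℕ) :
    (Finset.univ.filter fun e : (torusGraph 2 L).edgeSet =>
      (torusGraph 2 L).dist x (Quot.out e.1).1 ≤ R).card ≤ 4 * (2 * R + 1) ^ 2 := by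
  classical
  let F : (ℤ × ℤ) × (ℤ × ℤ) → (ZMod (2 * L) × ZMod (2 * L)) × (ZMod (2 * L) × ZMod (2 * L)) :=
    fun p => (torusResidue x + ((p.1.1 : ZMod (2 * L)), (p.1.2 : ZMod (2 * L))),
      torusResidue x + ((p.1.1 : ZMod (2 * L)), (p.1.2 : ZMod (2 * L)))
        + ((p.2.1 : ZMod (2 * L)), (p.2.2 : ZMod (2 * L))))
  let T : Finset ((ℤ × ℤ) × (ℤ × ℤ)) :=
    (Finset.Icc (-(R : ℤ)) R ×ˢ Finset.Icc (-(R : ℤ)) R) ×ˢ unitSteps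
  have hT : T.card = 4 * (2 * R + 1) ^ 2 := by
    have h4 : unitSteps.card = 4 := rfl
    have hR : ((R : ℤ) + 1 - -(R : ℤ)).toNat = 2 * R + 1 := by omega
    rw [Finset.card_product, Finset.card_product, h4, Int.card_Icc, hR]
    ring
  rw [← hT]
  refine (Finset.card_le_card_of_injOn (t := T.image F) (fun e : (torusGraph 2 L).edgeSet =>
    (torusResidue (Quot.out e.1).1, torusResidue (Quot.out e.1).2)) ?_ ?_).trans
    Finset.card_image_le
  · intro e he
    have hd : (torusGraph 2 L).dist x (Quot.out e.1).1 ≤ R := by simpa using he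
    obtain ⟨p, hp⟩ := (torusGraph_reachable x (Quot.out e.1).1).exists_walk_length_eq_dist
    obtain ⟨o, h1, h2, h3⟩ := exists_displacement_of_walk p
    obtain ⟨s, hs, h4⟩ := exists_unitStep_of_adj (adj_out _ e)
    have hR : (p.length : ℤ) ≤ R := by exact_mod_cast hp.trans_le hd
    refine Finset.mem_coe.2 (Finset.mem_image.2 ⟨(o, s), ?_, ?_⟩)
    · refine Finset.mem_product.2 ⟨Finset.mem_product.2 ⟨?_, ?_⟩, hs⟩
      · exact Finset.mem_Icc.2 (abs_le.1 (h1.trans hR))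
      · exact Finset.mem_Icc.2 (abs_le.1 (h2.trans hR))
    · simp only [F]
      rw [h4, h3]
  · intro e _ e' _ h
    rw [Prod.mk.injEq] at h
    have h1 := torusResidue_injective h.1
    have h2 := torusResidue_injective h.2
    refine Subtype.ext ?_
    rw [← Quot.out_eq e.1, ← Quot.out_eq e'.1, Prod.ext h1 h2]

/-! ### Dyadic cutoffs and the power law. -/

/-- The integer-valued cutoff which is `2 ^ k` on `[0, 2 ^ k]`, vanishes on `[2 ^ (k + 1), ∞)` and
is linear in between. -/
def dyadicCutoff (k m : ℕ) : ℕ := min (2 ^ k) (2 ^ (k + 1) - m)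

/-- A nonzero increment across neighbouring distances forces `2 ^ k ≤ min m m' < 2 ^ (k + 1)`. The
edge therefore determines the scale, and different cutoffs have disjoint gradients. -/
theorem dyadicCutoff_ne {k m m' : ℕ} (h : m ≤ m' + 1) (h' : m' ≤ m + 1)
    (hne : dyadicCutoff k m ≠ dyadicCutoff k m') :
    k = Nat.log 2 (min m m') ∧ m ≤ 2 ^ (k + 1) ∧
      |(dyadicCutoff k m : ℝ) - dyadicCutoff k m'| ≤ 1 := by
  have h1 : 2 ^ k ≤ min m m' ∧ min m m' < 2 ^ (k + 1) ∧ m ≤ 2 ^ (k + 1) ∧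
      |(dyadicCutoff k m : ℤ) - dyadicCutoff k m'| ≤ 1 := by
    rw [abs_le]
    unfold dyadicCutoff at hne ⊢
    rw [pow_succ] at hne ⊢
    generalize 2 ^ k = r at hne ⊢
    omega
  refine ⟨((Nat.log_eq_iff (Or.inr ⟨by norm_num, ?_⟩)).2 ⟨h1.1, h1.2.1⟩).symm, h1.2.2.1, by
    exact_mod_cast h1.2.2.2⟩
  have := Nat.two_pow_pos k
  omega

theorem abs_spinCorrelation_torusGraph_le {U D : ℝ → ℝ} {M : ℝ} (hM : 0 ≤ M)
    (hU : ContinuousOn U (Set.Icc (-1) 1))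
    (hD : ∀ p ∈ Set.Icc (-1 : ℝ) 1, |D p| ≤ M ∧
      ∀ q ∈ Set.Icc (-1 : ℝ) 1, |U q - U p - D p * (q - p)| ≤ M * (q - p) ^ 2)
    {n : ℕ} (hn : 2 ≤ n) {L : ℕ} {x y : TorusVertex 2 L} (hxy : x ≠ y) :
    |spinCorrelation (torusGraph 2 L) n U x y|
      ≤ 2 * n * (1 - 1 / (2 * Real.exp (36 * M * (Real.pi / 2) ^ 2 * 100)))
        ^ Nat.log 2 ((torusGraph 2 L).dist x y) := by
  set G := torusGraph 2 L
  -- The scales `k < K` have their transition completed by distance `2 ^ K ≤ dist x y`, and `2 ^ K`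
  -- is a common denominator of the cutoffs.
  set K := Nat.log 2 (G.dist x y) with hK
  have hadj : ∀ {u v}, G.Adj u v → G.dist x u ≤ G.dist x v + 1 ∧ G.dist x v ≤ G.dist x u + 1 := by
    intro u v h
    have := h.diff_dist_adj (u := x)
    omega
  have hcast : ∀ {k u v}, (dyadicCutoff k (G.dist x u) / 2 ^ k : ℝ)
      ≠ dyadicCutoff k (G.dist x v) / 2 ^ k →
      dyadicCutoff k (G.dist x u) ≠ dyadicCutoff k (G.dist x v) := by
    intro k u v h h'
    exact h (by rw [h'])
  have h := abs_spinCorrelation_le hM hU hD G hn (ι := Fin K) (N := 2 ^ K) (S := 100)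
    (φ := fun k u => (dyadicCutoff k (G.dist x u) / 2 ^ (k : ℕ) : ℝ)) (x := x) (y := y)
    ?_ (by positivity) ?_ (by norm_num) ?_ ?_ ?_
  · rwa [Fintype.card_fin] at h
  · intro u v huv k l hk hl
    obtain ⟨h1, h2⟩ := hadj huv
    exact Fin.ext ((dyadicCutoff_ne h1 h2 (hcast hk)).1.trans
      (dyadicCutoff_ne h1 h2 (hcast hl)).1.symm)
  · intro k u
    refine ⟨dyadicCutoff k (G.dist x u) * 2 ^ (K - k), ?_⟩
    have : (2 : ℝ) ^ K = 2 ^ (k : ℕ) * 2 ^ (K - k) := by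
      rw [← pow_add, Nat.add_sub_cancel' k.2.le]
    push_cast
    rw [this]
    field_simp
  · intro k
    have hle : ∀ e : G.edgeSet, ((dyadicCutoff k (G.dist x (Quot.out e.1).1) / 2 ^ (k : ℕ) : ℝ)
        - dyadicCutoff k (G.dist x (Quot.out e.1).2) / 2 ^ (k : ℕ)) ^ 2
        ≤ if G.dist x (Quot.out e.1).1 ≤ 2 ^ ((k : ℕ) + 1) then (1 / 4 ^ (k : ℕ) : ℝ) else 0 := by
      intro e
      obtain ⟨h1, h2⟩ := hadj (adj_out G e)
      by_cases hne : (dyadicCutoff k (G.dist x (Quot.out e.1).1) / 2 ^ (k : ℕ) : ℝ)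
        = dyadicCutoff k (G.dist x (Quot.out e.1).2) / 2 ^ (k : ℕ)
      · rw [hne, sub_self, zero_pow two_ne_zero]
        split_ifs <;> positivity
      · obtain ⟨-, h3, h4⟩ := dyadicCutoff_ne h1 h2 (hcast hne)
        rw [if_pos h3, ← sub_div, div_pow, ← pow_mul, mul_comm (k : ℕ) 2, pow_mul]
        norm_num only
        gcongr
        rw [← sq_abs]
        exact pow_le_one₀ (abs_nonneg _) h4
    refine (Finset.sum_le_sum fun e _ => hle e).trans ?_
    rw [← Finset.sum_filter, Finset.sum_const, nsmul_eq_mul, mul_one_div,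
      div_le_iff₀ (by positivity)]
    have hc := card_edges_near_le x (2 ^ ((k : ℕ) + 1))
    have hc' : (((Finset.univ.filter fun e : G.edgeSet =>
        G.dist x (Quot.out e.1).1 ≤ 2 ^ ((k : ℕ) + 1)).card : ℕ) : ℝ)
        ≤ 4 * (2 * 2 ^ ((k : ℕ) + 1) + 1) ^ 2 := by exact_mod_cast hc
    refine hc'.trans ?_
    have h4 : (4 : ℝ) ^ (k : ℕ) = (2 ^ (k : ℕ)) ^ 2 := by
      rw [← pow_mul, mul_comm, pow_mul]; norm_num
    have h2 : (1 : ℝ) ≤ 2 ^ (k : ℕ) := one_le_pow₀ (by norm_num)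
    rw [h4, pow_succ (2 : ℝ)]
    -- Writing `r = 2 ^ k ≥ 1`, one has `4 (4r + 1)² ≤ 4 (5r)² = 100 r²`, the source of the constant
    -- `100`.
    nlinarith [mul_nonneg (sub_nonneg.2 h2) (sub_nonneg.2 h2)]
  · intro k
    have : dyadicCutoff k (G.dist x x) = 2 ^ (k : ℕ) := by
      rw [SimpleGraph.dist_self, dyadicCutoff, pow_succ]
      omega
    rw [this]
    simp
  · intro k
    have hr : 2 ^ ((k : ℕ) + 1) ≤ G.dist x y :=
      (Nat.pow_le_pow_right (by norm_num) k.2).trans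
        (Nat.pow_log_le_self 2 ((torusGraph_reachable x y).pos_dist_of_ne hxy).ne')
    have : dyadicCutoff k (G.dist x y) = 0 := by
      rw [dyadicCutoff, Nat.sub_eq_zero_of_le hr, Nat.min_zero]
    rw [this]
    simp

/-- Since `r ≤ 2 ^ (log₂ r + 1)` and the exponent `logb 2 q` is negative, rounding the logarithm
costs only one factor `q⁻¹`. -/
theorem pow_log_two_le_rpow {q : ℝ} (hq0 : 0 < q) {r : ℕ} (hr : 1 ≤ r) (hq1 : q < 1) :
    q ^ Nat.log 2 r ≤ q⁻¹ * (r : ℝ) ^ (-(-Real.logb 2 q)) := by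
  have h1 : ((2 : ℝ) ^ (Nat.log 2 r + 1)) ^ Real.logb 2 q = q ^ (Nat.log 2 r + 1) := by
    rw [← Real.rpow_natCast, ← Real.rpow_mul (by norm_num), mul_comm, Real.rpow_mul (by norm_num),
      Real.rpow_logb (by norm_num) (by norm_num) hq0, Real.rpow_natCast]
  have h2 : (r : ℝ) ≤ 2 ^ (Nat.log 2 r + 1) := by
    exact_mod_cast (Nat.lt_pow_succ_log_self (by norm_num) r).le
  have h3 := Real.rpow_le_rpow_of_nonpos (by exact_mod_cast hr) h2
    (Real.logb_neg (b := 2) (by norm_num) hq0 hq1).le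
  rw [h1] at h3
  rw [neg_neg, ← div_eq_inv_mul, le_div_iff₀ hq0, ← pow_succ]
  exact h3

theorem mainTheorem2 (n : ℕ) (hn : 2 ≤ n) (U : ℝ → ℝ)
    (hU : ContDiffOn ℝ 2 U (Set.Icc (-1) 1)) :
    ∃ C : ℝ, 0 < C ∧ ∃ c : ℝ, 0 < c ∧
      ∀ (L : ℕ), 1 ≤ L → ∀ x y : TorusVertex 2 L, x ≠ y →
        |spinCorrelation (torusGraph 2 L) n U x y| ≤
          C * ((torusGraph 2 L).dist x y : ℝ) ^ (-c) := by
  obtain ⟨D, M, hM, hD⟩ := exists_taylor_bound hU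
  set q := 1 - 1 / (2 * Real.exp (36 * M * (Real.pi / 2) ^ 2 * 100)) with hq
  have hq0 : 0 < q := by
    have h1 : 1 ≤ Real.exp (36 * M * (Real.pi / 2) ^ 2 * 100) := Real.one_le_exp (by positivity)
    exact sub_pos.2 ((div_lt_one (by positivity)).2 (by linarith))
  have hq1 : q < 1 := sub_lt_self _ (by positivity)
  refine ⟨2 * n * q⁻¹, by positivity, -Real.logb 2 q,
    neg_pos.2 (Real.logb_neg (by norm_num) hq0 hq1), fun L _ x y hxy => ?_⟩
  refine (abs_spinCorrelation_torusGraph_le hM.le hU.continuousOn hD hn hxy).trans ?_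
  rw [mul_assoc (2 * (n : ℝ))]
  exact mul_le_mul_of_nonneg_left
    (pow_log_two_le_rpow hq0 ((torusGraph_reachable x y).pos_dist_of_ne hxy) hq1) (by positivity)
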